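/- For $m>0$ and $\rho>0$ let $\nu^{(m)}_\rho$ be the probability measure on $\{0,1,2,\dots\}$ given by $$\nu^{(m)}_\rho(n)=\frac{1}{z(\phi_m(\rho))}\,\phi_m(\rho)^n\,\frac{\Gamma(\frac m2+n)}{n!\,\Gamma(\frac m2)},\qquad \phi_m(\rho)=\frac{\rho}{m/2+\rho},\qquad z(\phi)=\sum_{n\ge 0}\phi^n\frac{\Gamma(\frac m2+n)}{n!\,\Gamma(\frac m2)} .$$ Fix $\rho>0$. For every $m>0$ let $\eta_1,\eta_2,\dots$ be i.i.d. random variables with law $\nu^{(m)}_\rho$ (on a probability space that may depend on $m$), let $K_m\ge 1$ be an integer, and let $\kappa_m=-1/(m\log m)$. Put $$\Delta_{K_m}=\#\{1\le i\le K_m:\eta_i\neq 0\},\qquad S_{K_m}=\frac1{K_m}\sum_{i=1}^{K_m}\eta_i .$$ Then the following hold as $m\to0^+$. (1) If $K_m/\kappa_m\to 0$, then $\Delta_{K_m}\to 0$ in distribution. If $K_m/\kappa_m\to\delta\in(0,\infty)$, then $\Delta_{K_m}$ converges in distribution to a Poisson random variable with mean $\delta/2$. If $K_m/\kappa_m\to\infty$,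 then $\Delta_{K_m}\to\infty$ in distribution (as $[0,\infty]$-valued random variables), and moreover $\Delta_{K_m}=\frac{K_m}{2\kappa_m}(1+o(1))$, i.e. $\Delta_{K_m}\big/\frac{K_m}{2\kappa_m}\to1$ in probability. (2) The scale $1/m$ is larger than $\kappa_m$, i.e. $(1/m)/\kappa_m\to\infty$. If $mK_m\to0$, then $S_{K_m}\to0$ in distribution. If $mK_m\to\gamma\in(0,\infty)$, then $S_{K_m}$ converges in distribution to a Gamma random variable with shape $\gamma/2$ and scale $2\rho/\gamma$, which has mean $\rho$. If $mK_m\to\infty$, then $S_{K_m}\to\rho$ in distribution. -/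

import Mathlib

open MeasureTheory ProbabilityTheory Filter Topology

open scoped ENNReal

noncomputable section

namespace InclusionProcess

/-- The weight `φⁿ Γ(m/2 + n) / (n! Γ(m/2))` of `n` particles at one site. -/
def weight (m φ : ℝ) (n : ℕ) : ℝ :=
  φ ^ n * (Real.Gamma (m / 2 + n) / (n.factorial * Real.Gamma (m / 2)))

/-- The normalizing constant `z(φ)`. -/
def z (m φ : ℝ) : ℝ := ∑' n : ℕ, weight m φ n

/-- The single-site marginal with fugacity `φ`, as a measure on `ℕ`. -/
def marginal (m φ : ℝ) : Measure ℕ :=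
  Measure.sum fun n : ℕ => ENNReal.ofReal ((z m φ)⁻¹ * weight m φ n) • Measure.dirac n

/-- The fugacity `φ_m(ρ)` at which the average number of particles per site is `ρ`. -/
def fugacity (m ρ : ℝ) : ℝ := ρ / (m / 2 + ρ)

/-- The single-site marginal `ν_ρ^{(m)}` indexed by the density `ρ`. -/
def nu (m ρ : ℝ) : Measure ℕ := marginal m (fugacity m ρ)

/-- The scale `κ_m = -1 / (m log m)`. -/
def kappa (m : ℝ) : ℝ := -1 / (m * Real.log m)

/-- The range of the parameter `m`. -/
abbrev Param : Type := {m : ℝ // 0 < m}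

/-- The limit `m → 0` through positive values. -/
def toZero : Filter Param := comap (fun m : Param => (m : ℝ)) (𝓝 0)

/-- `Δ_K`: the number of nonzero ones among the first `K` variables (numbered from `0`). -/
def numOccupied {Ω : Type*} (η : ℕ → Ω → ℕ) (K : ℕ) (ω : Ω) : ℕ :=
  ∑ i ∈ Finset.range K, if η i ω = 0 then 0 else 1

/-- `S_K`: the empirical mean of the first `K` variables. -/
def empiricalMean {Ω : Type*} (η : ℕ → Ω → ℕ) (K : ℕ) (ω : Ω) : ℝ :=
  (1 / (K : ℝ)) * ∑ i ∈ Finset.range K, (η i ω : ℝ)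

/-- `X i` converges in distribution, along `l`, to a random variable with law `ν`
(which is in particular a probability measure). A constant limit `c` is the law `dirac c`. -/
def TendstoInLaw {ι E : Type*} {Ω : ι → Type*} [∀ i, MeasurableSpace (Ω i)]
    [TopologicalSpace E] [MeasurableSpace E] [OpensMeasurableSpace E]
    (P : ∀ i, Measure (Ω i)) [∀ i, IsProbabilityMeasure (P i)]
    (X : ∀ i, Ω i → E) (l : Filter ι) (ν : Measure E) : Prop :=
  ∃ _ : IsProbabilityMeasure ν, TendstoInDistribution X l (fun x : E => x) P ν

end InclusionProcess

end

namespace InclusionProcess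

/-! By the binomial series a site has generating function E[w^η] = (1 + (2ρ/m)(1 - w))^(-m/2) for
|w| ≤ 1. Both statistics are built from sums of i.i.d. terms, so their characteristic functions are
explicit, and Lévy's theorem reduces all the real-valued limits in law to limits of complex
functions.

A site is empty with probability (m/(m+2ρ))^(m/2) = exp((m log m)/2 + O(m)), hence occupied with
probability p ~ -(m log m)/2 = 1/(2κ_m) (`tendsto_occupiedProb_mul_kappa`). So Δ is binomial with
mean Kp ~ K/(2κ_m). It has a Poisson limit when this mean converges, and Chebyshev's inequality
makes it concentrate when the mean diverges.

With s = mK and y = K(1 - e^{it/K}), the characteristic function of S at t is (1 + 2ρy/s)^(-s/2). If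
s stays away from 0, then K → ∞ and y → -it: the limit is the Gamma characteristic function when s →
γ, and e^{iρt} when s → ∞. If s → 0, the bound |y| ≤ |t| makes the logarithm O(|log s|), and s log s
→ 0. -/

/-! ### Generating function of the single-site marginal -/

-- The ratio Γ(m/2 + n)/Γ(m/2) is a rising factorial, so the weights are the coefficients of a
-- binomial series.
open Complex in
lemma weight_eq_choose {m : ℝ} (hm : 0 < m) (φ : ℝ) (n : ℕ) :
    (weight m φ n : ℂ) = φ ^ n * Ring.choose ((m / 2 : ℂ) + n - 1) n := by
  have hΓ : ∀ k : ℕ, Real.Gamma (m / 2 + k) =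
      (ascPochhammer ℝ k).eval (m / 2) * Real.Gamma (m / 2) := by
    intro k
    induction k with
    | zero => simp
    | succ k ih =>
      have : m / 2 + (k + 1 : ℕ) = (m / 2 + k) + 1 := by push_cast; ring
      rw [this, Real.Gamma_add_one (by positivity), ih, ascPochhammer_succ_eval]
      ring
  have hch : (n.factorial : ℝ) * Ring.choose (m / 2 + n - 1) n =
      (ascPochhammer ℝ n).eval (m / 2) := by
    rw [← Ring.multichoose_eq, ← nsmul_eq_mul, Ring.factorial_nsmul_multichoose_eq_ascPochhammer,
      Polynomial.ascPochhammer_smeval_eq_eval]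
  have h1 : (Real.Gamma (m / 2)) ≠ 0 := (Real.Gamma_pos_of_pos (by positivity)).ne'
  have h2 : (n.factorial : ℝ) ≠ 0 := by positivity
  have : weight m φ n = φ ^ n * Ring.choose (m / 2 + n - 1) n := by
    rw [weight, hΓ, ← hch]
    field_simp
  rw [this]
  push_cast
  rfl

lemma hasSum_weight_mul_pow {m φ : ℝ} (hm : 0 < m) (h0 : 0 ≤ φ) (h1 : φ < 1) {w : ℂ}
    (hw : ‖w‖ ≤ 1) :
    HasSum (fun n => (weight m φ n : ℂ) * w ^ n) (1 / (1 - φ * w) ^ (m / 2 : ℂ)) := by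
  have h := Complex.one_div_one_sub_cpow_hasFPowerSeriesOnBall_zero (m / 2 : ℂ)
  have hmem : (φ * w : ℂ) ∈ Metric.eball (0 : ℂ) 1 := by
    rw [← ENNReal.ofReal_one, Metric.eball_ofReal, mem_ball_zero_iff, norm_mul, Complex.norm_real,
      Real.norm_of_nonneg h0]
    exact (mul_le_of_le_one_right h0 hw).trans_lt h1
  have h2 := h.hasSum hmem
  rw [zero_add] at h2
  refine h2.congr_fun ?_
  intro n
  simp [weight_eq_choose hm, mul_pow]
  ring

lemma hasSum_weight {m φ : ℝ} (hm : 0 < m) (h0 : 0 ≤ φ) (h1 : φ < 1) :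
    HasSum (weight m φ) ((1 - φ) ^ (-(m / 2))) := by
  have h := hasSum_weight_mul_pow hm h0 h1 (w := 1) (by simp)
  rw [← Complex.hasSum_ofReal]
  convert h using 1
  · simp
  · rw [Complex.ofReal_cpow (by linarith), one_div, ← Complex.cpow_neg]
    push_cast
    simp

lemma weight_nonneg {m φ : ℝ} (hm : 0 < m) (h0 : 0 ≤ φ) (n : ℕ) : 0 ≤ weight m φ n := by
  unfold weight
  positivity

lemma z_eq {m φ : ℝ} (hm : 0 < m) (h0 : 0 ≤ φ) (h1 : φ < 1) :
    z m φ = (1 - φ) ^ (-(m / 2)) := (hasSum_weight hm h0 h1).tsum_eq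

lemma integral_nu {m ρ : ℝ} (hm : 0 < m) (hρ : 0 < ρ) (f : ℕ → ℂ) :
    ∫ n, f n ∂(nu m ρ) =
      ∑' n, (((z m (fugacity m ρ))⁻¹ * weight m (fugacity m ρ) n : ℝ) : ℂ) * f n := by
  have h0 : 0 ≤ fugacity m ρ := by unfold fugacity; positivity
  have hz : 0 ≤ z m (fugacity m ρ) := tsum_nonneg (weight_nonneg hm h0)
  rw [nu, marginal, integral_sum_dirac (by simp)]
  congr with n
  rw [ENNReal.toReal_ofReal (mul_nonneg (inv_nonneg.2 hz) (weight_nonneg hm h0 n)),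
    Complex.real_smul]

lemma one_sub_fugacity {m ρ : ℝ} (hm : 0 < m) (hρ : 0 < ρ) :
    1 - fugacity m ρ = m / (m + 2 * ρ) := by
  unfold fugacity
  field_simp
  ring

/-- The probability that a site is empty. -/
noncomputable def emptyProb (m ρ : ℝ) : ℝ := (m / (m + 2 * ρ)) ^ (m / 2)

lemma inv_z {m ρ : ℝ} (hm : 0 < m) (hρ : 0 < ρ) :
    (z m (fugacity m ρ))⁻¹ = emptyProb m ρ := by
  have h : 0 < m / (m + 2 * ρ) := by positivity
  have h0 : 0 ≤ fugacity m ρ := by unfold fugacity; positivity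
  have h1 := one_sub_fugacity hm hρ
  rw [z_eq hm h0 (by linarith), h1, Real.rpow_neg h.le, inv_inv, emptyProb]

/-- The probability generating function of the single-site marginal. -/
lemma integral_pow_nu {m ρ : ℝ} (hm : 0 < m) (hρ : 0 < ρ) {w : ℂ} (hw : ‖w‖ ≤ 1) :
    ∫ n, w ^ n ∂(nu m ρ) = Complex.exp (-(m / 2) * Complex.log (1 + 2 * ρ / m * (1 - w))) := by
  have h : 0 < m / (m + 2 * ρ) := by positivity
  have h0 : 0 ≤ fugacity m ρ := by unfold fugacity; positivity
  have h1 := one_sub_fugacity hm hρ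
  rw [integral_nu hm hρ]
  have hre : 0 < (1 + 2 * ρ / m * (1 - w) : ℂ).re := by
    have h2 : w.re ≤ 1 := (Complex.re_le_norm w).trans hw
    have : (1 + 2 * ρ / m * (1 - w) : ℂ).re = 1 + 2 * ρ / m * (1 - w.re) := by
      rw [show (2 * ρ / m : ℂ) = ((2 * ρ / m : ℝ) : ℂ) by push_cast; rfl, Complex.add_re,
        Complex.re_ofReal_mul]
      simp
    rw [this]
    have : 0 ≤ 2 * ρ / m * (1 - w.re) := mul_nonneg (by positivity) (by linarith)
    linarith
  have hne : (1 + 2 * ρ / m * (1 - w) : ℂ) ≠ 0 := fun hh => by simp [hh] at hre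
  -- This is 1 - φw = (1 - φ)(1 + (2ρ/m)(1 - w)); after raising to the power -m/2, the factor 1 - φ
  -- cancels against the normalization.
  have hfac : (1 - fugacity m ρ * w : ℂ) =
      ((m / (m + 2 * ρ) : ℝ) : ℂ) * (1 + 2 * ρ / m * (1 - w)) := by
    have e1 : fugacity m ρ = 1 - m / (m + 2 * ρ) := by linarith
    have hmc : (m : ℂ) ≠ 0 := by exact_mod_cast hm.ne'
    have hmc' : (m + 2 * ρ : ℂ) ≠ 0 := by exact_mod_cast (by positivity : m + 2 * ρ ≠ 0)
    rw [e1]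
    push_cast
    field_simp
    ring
  have h3 := (hasSum_weight_mul_pow hm h0 (by linarith) hw).mul_left
    ((emptyProb m ρ : ℝ) : ℂ)
  rw [inv_z hm hρ]
  simp_rw [Complex.ofReal_mul, mul_assoc]
  rw [h3.tsum_eq, hfac, emptyProb, Complex.cpow_def_of_ne_zero
    (mul_ne_zero (by exact_mod_cast h.ne') hne), Complex.log_ofReal_mul h hne,
    Real.rpow_def_of_pos h, one_div, ← Complex.exp_neg, Complex.ofReal_exp, ← Complex.exp_add]
  congr 1
  push_cast
  ring

lemma nu_singleton_zero {m ρ : ℝ} (hm : 0 < m) (hρ : 0 < ρ) :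
    nu m ρ {0} = ENNReal.ofReal (emptyProb m ρ) := by
  rw [nu, marginal, Measure.sum_smul_dirac_singleton, inv_z hm hρ]
  have : Real.Gamma (m / 2) ≠ 0 := (Real.Gamma_pos_of_pos (by positivity)).ne'
  simp [weight, this]

lemma emptyProb_nonneg {m ρ : ℝ} (hm : 0 < m) (hρ : 0 < ρ) : 0 ≤ emptyProb m ρ := by
  unfold emptyProb
  positivity

/-! ### Criteria for convergence in law -/

section Convergence

variable {ι : Type*} {l : Filter ι} {Ω : ι → Type*}
  [∀ i, MeasurableSpace (Ω i)] {P : ∀ i, Measure (Ω i)} [∀ i, IsProbabilityMeasure (P i)]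

/-- Lévy's continuity theorem along a countably generated filter. -/
lemma tendstoInLaw_of_tendsto_charFun [l.IsCountablyGenerated] {X : ∀ i, Ω i → ℝ}
    {ν : Measure ℝ} [IsProbabilityMeasure ν]
    (hX : ∀ i, AEMeasurable (X i) (P i))
    (h : ∀ t, Tendsto (fun i => charFun ((P i).map (X i)) t) l (𝓝 (charFun ν t))) :
    TendstoInLaw P X l ν := by
  refine ⟨inferInstance, ⟨hX, aemeasurable_id, ?_⟩⟩
  refine Filter.tendsto_of_seq_tendsto fun u hu => ?_
  refine ProbabilityMeasure.tendsto_of_tendsto_charFun fun t => ?_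
  have h' := (h t).comp hu
  rw [← Measure.map_id' (μ := ν)] at h'
  exact h'

/-- Since ℕ is closed in ℝ, Tietze extends every bounded test function on ℕ to ℝ. This makes
characteristic functions available for ℕ-valued variables. -/
lemma TendstoInLaw.of_natCast {X : ∀ i, Ω i → ℕ} {ν : Measure ℕ} [IsProbabilityMeasure ν]
    (hX : ∀ i, AEMeasurable (X i) (P i))
    (h : TendstoInLaw P (fun i ω => (X i ω : ℝ)) l (ν.map (Nat.cast : ℕ → ℝ))) :
    TendstoInLaw P X l ν := by
  obtain ⟨_, h⟩ := h
  refine ⟨inferInstance, ⟨hX, aemeasurable_id, ?_⟩⟩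
  refine ProbabilityMeasure.tendsto_iff_forall_integral_tendsto.2 fun f => ?_
  obtain ⟨g, -, hg⟩ := BoundedContinuousFunction.exists_extension_norm_eq_of_isClosedEmbedding f
    Nat.isClosedEmbedding_coe_real
  have hg' : ∀ n : ℕ, g n = f n := fun n => congrFun hg n
  have h2 := ProbabilityMeasure.tendsto_iff_forall_integral_tendsto.1 h.tendsto g
  simp only [ProbabilityMeasure.coe_mk] at h2 ⊢
  convert! h2 using 1
  · ext i
    rw [integral_map (hX i) (by fun_prop),
      integral_map (φ := fun ω => (X i ω : ℝ))
        (Measurable.of_discrete.comp_aemeasurable (hX i)) (by fun_prop)]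
    simp [hg']
  · rw [Measure.map_id', Measure.map_id', integral_map .of_discrete (by fun_prop)]
    simp [hg']

/-- Portmanteau with open sets: an open set containing ∞ contains all x > c for some natural c, and
its mass is then at least 1 - P(X ≤ c). -/
lemma tendstoInLaw_dirac_top [l.IsCountablyGenerated] {X : ∀ i, Ω i → ℕ}
    (hX : ∀ i, AEMeasurable (X i) (P i))
    (h : ∀ c : ℕ, Tendsto (fun i => P i {ω | X i ω ≤ c}) l (𝓝 0)) :
    TendstoInLaw P (fun i ω => (X i ω : ℝ≥0∞)) l (Measure.dirac ∞) := by
  have hX' : ∀ i, AEMeasurable (fun ω => (X i ω : ℝ≥0∞)) (P i) := fun i =>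
    Measurable.of_discrete.comp_aemeasurable (hX i)
  refine ⟨inferInstance, ⟨hX', aemeasurable_id, ?_⟩⟩
  refine tendsto_of_forall_isOpen_le_liminf' fun G hG => ?_
  change (Measure.dirac ∞).map (fun x : ℝ≥0∞ => x) G ≤
    l.liminf fun i => (P i).map (fun ω => (X i ω : ℝ≥0∞)) G
  rw [Measure.map_id']
  by_cases hmem : ∞ ∈ G
  · obtain ⟨a, ha, haG⟩ := ENNReal.nhds_top_basis.mem_iff.1 (hG.mem_nhds hmem)
    obtain ⟨c, hc⟩ := ENNReal.exists_nat_gt ha.ne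
    rcases l.eq_or_neBot with rfl | _
    · simp
    have hlim : Tendsto (fun i => 1 - P i {ω | X i ω ≤ c}) l (𝓝 1) := by
      simpa using ENNReal.Tendsto.sub tendsto_const_nhds (h c) (Or.inl ENNReal.one_ne_top)
    rw [Measure.dirac_apply_of_mem hmem, ← hlim.liminf_eq]
    refine liminf_le_liminf (Eventually.of_forall fun i => ?_)
    rw [Measure.map_apply_of_aemeasurable (hX' i) hG.measurableSet, tsub_le_iff_right,
      ← measure_univ (μ := P i)]
    refine (measure_mono fun ω _ => ?_).trans (measure_union_le _ _)
    rcases le_or_gt (X i ω) c with hω | hω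
    · exact Or.inr hω
    · exact Or.inl (haG (hc.trans (Nat.cast_lt.2 hω)))
  · rw [Measure.dirac_apply' _ hG.measurableSet]
    simp [hmem]

end Convergence

/-- Since log(1 + y) - y = O(y²), replacing the logarithm by y costs O((ky)y), which tends to 0. -/
lemma tendsto_mul_log_one_add {ι : Type*} {l : Filter ι} {k y : ι → ℂ} {c : ℂ}
    (hy : Tendsto y l (𝓝 0)) (hk : Tendsto (fun i => k i * y i) l (𝓝 c)) :
    Tendsto (fun i => k i * Complex.log (1 + y i)) l (𝓝 c) := by
  have h1 : (fun i => k i * (Complex.log (1 + y i) - y i)) =O[l] fun i => (k i * y i) * y i :=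
    ((Asymptotics.isBigO_refl k l).mul
      (Complex.log_sub_self_isBigO.comp_tendsto hy)).congr_right fun i => by
        simp only [Function.comp]; ring
  have h2 : Tendsto (fun i => (k i * y i) * y i) l (𝓝 0) := by simpa using hk.mul hy
  have h3 := (h1.trans_tendsto h2).add hk
  rw [zero_add] at h3
  exact h3.congr fun i => by ring

/-! ### Mean and characteristic function of the Gamma law -/

section GammaLaw

variable {a r : ℝ}

lemma integral_gammaMeasure (ha : 0 < a) (hr : 0 < r) (f : ℝ → ℝ) :
    ∫ x, f x ∂(gammaMeasure a r) =
      ∫ x in Set.Ioi 0, (r ^ a / Real.Gamma a * x ^ (a - 1) * Real.exp (-(r * x))) * f x := by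
  have hmeas : Measurable (gammaPDF a r) := (measurable_gammaPDFReal a r).ennreal_ofReal
  rw [gammaMeasure, integral_withDensity_eq_integral_toReal_smul hmeas (by simp [gammaPDF]),
    ← integral_Ici_eq_integral_Ioi, ← integral_indicator measurableSet_Ici]
  congr with x
  rw [gammaPDF, ENNReal.toReal_ofReal (gammaPDFReal_nonneg ha hr x), gammaPDFReal]
  by_cases hx : 0 ≤ x <;> simp [hx]

lemma integral_id_gammaMeasure (ha : 0 < a) (hr : 0 < r) :
    ∫ x, x ∂(gammaMeasure a r) = a / r := by
  have h : ∀ x ∈ Set.Ioi (0 : ℝ), r ^ a / Real.Gamma a * x ^ (a - 1) * Real.exp (-(r * x)) * x =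
      r ^ a / Real.Gamma a * (x ^ ((a + 1) - 1) * Real.exp (-(r * x))) := fun x hx => by
    rw [add_sub_cancel_right, Real.rpow_sub_one (ne_of_gt hx)]
    have : x ≠ 0 := ne_of_gt hx
    field_simp
  rw [integral_gammaMeasure ha hr, setIntegral_congr_fun measurableSet_Ioi h, integral_const_mul,
    Real.integral_rpow_mul_exp_neg_mul_Ioi (by linarith) hr, Real.Gamma_add_one ha.ne',
    Real.rpow_add_one (by positivity), one_div, Real.inv_rpow hr.le]
  have := (Real.Gamma_pos_of_pos ha).ne'
  field_simp

/-- The integral of a non-integrable function is 0 by convention, whereas the computed value a/r is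
positive. -/
lemma integrable_id_gammaMeasure (ha : 0 < a) (hr : 0 < r) :
    Integrable (fun x : ℝ => x) (gammaMeasure a r) := by
  by_contra h
  have := integral_undef h
  rw [integral_id_gammaMeasure ha hr] at this
  exact (div_pos ha hr).ne' this

lemma mgf_id_gammaMeasure (ha : 0 < a) (hr : 0 < r) {s : ℝ} (hs : s < r) :
    mgf id (gammaMeasure a r) s = (1 - s / r) ^ (-a) := by
  have h : ∀ x : ℝ, r ^ a / Real.Gamma a * x ^ (a - 1) * Real.exp (-(r * x)) *
      Real.exp (s * x) =
      r ^ a / Real.Gamma a * (x ^ (a - 1) * Real.exp (-((r - s) * x))) := fun x => by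
    rw [mul_assoc, ← Real.exp_add, mul_assoc]
    ring_nf
  have hrs : 0 < r - s := sub_pos.2 hs
  have e : 1 - s / r = (r - s) / r := by field_simp
  simp only [mgf, id]
  rw [integral_gammaMeasure ha hr]
  simp_rw [h]
  rw [integral_const_mul, Real.integral_rpow_mul_exp_neg_mul_Ioi ha hrs, e, one_div,
    Real.inv_rpow hrs.le, Real.rpow_neg (by positivity), Real.div_rpow hrs.le hr.le]
  have := (Real.Gamma_pos_of_pos ha).ne'
  field_simp

/-- The complex moment generating function and (1 - z/r)^(-a) are analytic on Re z < r and agree at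
real points near 0. The identity theorem extends this to z = it. -/
lemma charFun_gammaMeasure (ha : 0 < a) (hr : 0 < r) (t : ℝ) :
    charFun (gammaMeasure a r) t =
      Complex.exp (-a * Complex.log (1 - t * Complex.I / r)) := by
  -- Without integrability `mgf` would take its default value 0, but the formula for it is positive.
  have hset : Set.Iio r ⊆ integrableExpSet id (gammaMeasure a r) := fun s hs => by
    by_contra h
    have h0 := mgf_undef h
    rw [mgf_id_gammaMeasure ha hr hs] at h0
    have : 0 < 1 - s / r := sub_pos.2 ((div_lt_one hr).2 hs)
    exact (Real.rpow_pos_of_pos this _).ne' h0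
  have hint : Set.Iio r ⊆ interior (integrableExpSet id (gammaMeasure a r)) :=
    interior_maximal hset isOpen_Iio
  let U : Set ℂ := {z | z.re < r}
  have hU : IsOpen U := isOpen_lt Complex.continuous_re continuous_const
  have hUc : IsPreconnected U := (convex_halfSpace_re_lt r).isPreconnected
  have hslit : ∀ z ∈ U, (1 - z / r) ∈ Complex.slitPlane := fun z hz => by
    refine Or.inl ?_
    rw [Complex.sub_re, Complex.div_ofReal_re, Complex.one_re]
    exact sub_pos.2 ((div_lt_one hr).2 hz)
  have hf : AnalyticOnNhd ℂ (complexMGF id (gammaMeasure a r)) U :=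
    analyticOnNhd_complexMGF.mono fun z hz => hint hz
  have hg : AnalyticOnNhd ℂ (fun z : ℂ => Complex.exp (-a * Complex.log (1 - z / r))) U := by
    refine DifferentiableOn.analyticOnNhd (fun z hz => ?_) hU
    refine DifferentiableAt.differentiableWithinAt ?_
    have h1 : DifferentiableAt ℂ (fun z : ℂ => 1 - z / r) z := by fun_prop
    exact ((h1.clog (hslit z hz)).const_mul _).cexp
  have heq := hf.eqOn_of_preconnected_of_frequently_eq hg hUc (z₀ := 0) (by simpa [U] using hr) ?_
  · rw [← complexMGF_id_mul_I, heq (by simpa [U] using hr)]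
  · have hreal : ∃ᶠ s : ℝ in 𝓝[≠] 0, complexMGF id (gammaMeasure a r) s =
        Complex.exp (-a * Complex.log (1 - s / r)) := by
      refine Eventually.frequently ?_
      filter_upwards [eventually_nhdsWithin_of_eventually_nhds (eventually_lt_nhds hr)] with s hs
      have : 0 < 1 - s / r := sub_pos.2 ((div_lt_one hr).2 hs)
      rw [complexMGF_ofReal, mgf_id_gammaMeasure ha hr hs, Real.rpow_def_of_pos this]
      push_cast [Complex.ofReal_log this.le]
      rw [mul_comm]
    refine Tendsto.frequently (f := fun s : ℝ => (s : ℂ)) ?_ hreal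
    refine tendsto_nhdsWithin_iff.2 ⟨?_, ?_⟩
    · exact (Complex.continuous_ofReal.tendsto' 0 0 (by simp)).mono_left nhdsWithin_le_nhds
    · filter_upwards [self_mem_nhdsWithin] with s hs
      simpa using hs

end GammaLaw

/-! ### Asymptotics of the scale and of the occupation probability -/

section Asymptotics

lemma tendsto_coe_toZero : Tendsto (fun m : Param => (m : ℝ)) toZero (𝓝[>] 0) :=
  tendsto_nhdsWithin_iff.2 ⟨tendsto_comap, Eventually.of_forall fun m => m.2⟩

lemma tendsto_mul_log_toZero :
    Tendsto (fun m : Param => (m : ℝ) * Real.log m) toZero (𝓝 0) := by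
  refine ((tendsto_log_mul_rpow_nhdsGT_zero one_pos).comp tendsto_coe_toZero).congr fun m => ?_
  simp [mul_comm]

lemma tendsto_log_toZero : Tendsto (fun m : Param => Real.log m) toZero atBot :=
  Real.tendsto_log_nhdsGT_zero.comp tendsto_coe_toZero

lemma eventually_kappa_pos : ∀ᶠ m : Param in toZero, 0 < kappa m := by
  filter_upwards [tendsto_log_toZero.eventually_lt_atBot 0] with m hm
  exact div_pos_of_neg_of_neg (by norm_num) (mul_neg_of_pos_of_neg m.2 hm)

lemma tendsto_inv_div_kappa :
    Tendsto (fun m : Param => (1 / (m : ℝ)) / kappa m) toZero atTop := by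
  refine (tendsto_neg_atBot_atTop.comp tendsto_log_toZero).congr fun m => ?_
  have := m.2.ne'
  simp only [Function.comp, kappa]
  field_simp

/-- Write the empty probability as e^u with u = (m/2)(log m - log(m + 2ρ)) → 0. Then 1 - e^u ~ -u,
and -uκ_m = 1/2 - log(m + 2ρ)/(2 log m). -/
lemma tendsto_occupiedProb_mul_kappa {ρ : ℝ} (hρ : 0 < ρ) :
    Tendsto (fun m : Param => (1 - emptyProb m ρ) * kappa m) toZero (𝓝 (1 / 2)) := by
  have hm0 : Tendsto (fun m : Param => (m : ℝ)) toZero (𝓝 0) := tendsto_comap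
  have hlog : Tendsto (fun m : Param => Real.log (m + 2 * ρ)) toZero (𝓝 (Real.log (2 * ρ))) := by
    have : Tendsto (fun m : Param => (m : ℝ) + 2 * ρ) toZero (𝓝 (2 * ρ)) := by
      simpa using hm0.add_const (2 * ρ)
    exact this.log (by positivity)
  let u : Param → ℝ := fun m => (m / 2 : ℝ) * (Real.log m - Real.log (m + 2 * ρ))
  have hu : ∀ m : Param, emptyProb m ρ = Real.exp (u m) := fun m => by
    have := m.2
    rw [emptyProb, Real.rpow_def_of_pos (by positivity), Real.log_div (by positivity)
      (by positivity), mul_comm]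
  have hu0 : Tendsto u toZero (𝓝 0) := by
    have : Tendsto (fun m : Param => (1 / 2 : ℝ) * (m * Real.log m) -
        (m / 2 : ℝ) * Real.log (m + 2 * ρ)) toZero (𝓝 (1 / 2 * 0 - 0 / 2 * Real.log (2 * ρ))) :=
      (tendsto_mul_log_toZero.const_mul _).sub ((hm0.div_const 2).mul hlog)
    refine (this.congr fun m => ?_).trans (by simp)
    simp only [u]; ring
  have hne : ∀ᶠ m in toZero, u m ≠ 0 := by
    refine Eventually.of_forall fun m => ?_
    have : Real.log m < Real.log (m + 2 * ρ) := Real.log_lt_log m.2 (by linarith [m.2])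
    exact (mul_neg_of_pos_of_neg (half_pos m.2) (by linarith)).ne
  have hslope : Tendsto (fun m => (Real.exp (u m) - 1) / u m) toZero (𝓝 1) := by
    have h := (Real.hasDerivAt_exp 0).tendsto_slope
    rw [Real.exp_zero] at h
    refine (h.comp (tendsto_nhdsWithin_iff.2 ⟨hu0, hne⟩)).congr fun m => ?_
    simp [slope_def_field]
  have huk : Tendsto (fun m : Param => -(u m * kappa m)) toZero (𝓝 (1 / 2)) := by
    have : Tendsto (fun m : Param => 1 / 2 - 1 / 2 * (Real.log (m + 2 * ρ) / Real.log m)) toZero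
        (𝓝 (1 / 2 - 1 / 2 * 0)) :=
      ((hlog.div_atBot tendsto_log_toZero).const_mul _).const_sub _
    rw [mul_zero, sub_zero] at this
    refine this.congr' ?_
    filter_upwards [tendsto_log_toZero.eventually_lt_atBot 0] with m hm
    have h1 := m.2.ne'
    have h2 := hm.ne
    simp only [u, kappa]
    field_simp
  refine ((hslope.mul huk).congr' ?_).trans (by simp)
  filter_upwards [hne] with m hm
  rw [hu]
  field_simp
  ring

end Asymptotics

/-! ### Sums over independent sites -/

section Sums

variable {Ω : Type*} [MeasurableSpace Ω] {P : Measure Ω}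
  {η : ℕ → Ω → ℕ} {m ρ : ℝ}

lemma aemeasurable_numOccupied (hη : ∀ i, AEMeasurable (η i) P) (K : ℕ) :
    AEMeasurable (numOccupied η K) P := by
  refine Finset.aemeasurable_fun_sum _ fun i _ => ?_
  exact (Measurable.of_discrete (f := fun n : ℕ => if n = 0 then 0 else 1)).comp_aemeasurable (hη i)

lemma aemeasurable_empiricalMean (hη : ∀ i, AEMeasurable (η i) P) (K : ℕ) :
    AEMeasurable (empiricalMean η K) P := by
  refine (Finset.aemeasurable_fun_sum _ fun i _ => ?_).const_mul _
  exact (Measurable.of_discrete (f := fun n : ℕ => (n : ℝ))).comp_aemeasurable (hη i)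

lemma charFun_sum (hlaw : ∀ i, HasLaw (η i) (nu m ρ) P) (hindep : iIndepFun η P)
    (g : ℕ → ℝ) (K : ℕ) (t : ℝ) :
    charFun (P.map fun ω => ∑ i ∈ Finset.range K, g (η i ω)) t =
      (∫ n, Complex.exp (t * g n * Complex.I) ∂(nu m ρ)) ^ K := by
  have hg : ∀ i, AEMeasurable (fun ω => g (η i ω)) P := fun i =>
    Measurable.of_discrete.comp_aemeasurable (hlaw i).aemeasurable
  have hind : iIndepFun (fun i ω => g (η i ω)) P :=
    hindep.comp (fun _ => g) fun _ => .of_discrete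
  rw [iIndepFun.charFun_map_fun_finsetSum_eq_prod (X := fun i ω => g (η i ω)) (fun i _ => hg i)
    (hind.restrict _), Finset.prod_apply]
  rw [Finset.prod_congr rfl fun i _ => ?_, Finset.prod_const, Finset.card_range]
  rw [charFun_apply_real, integral_map (hg i) (by fun_prop), ← (hlaw i).map_eq,
    integral_map (hlaw i).aemeasurable .of_discrete]

lemma charFun_empiricalMean (hm : 0 < m) (hρ : 0 < ρ) (hlaw : ∀ i, HasLaw (η i) (nu m ρ) P)
    (hindep : iIndepFun η P) (K : ℕ) (t : ℝ) :
    charFun (P.map (empiricalMean η K)) t =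
      Complex.exp (-(K * m / 2) * Complex.log
        (1 + 2 * ρ / m * (1 - Complex.exp (t / K * Complex.I)))) := by
  have h := charFun_sum hlaw hindep (fun n => 1 / K * n) K t
  have hw : ‖Complex.exp (t / K * Complex.I)‖ ≤ 1 := by
    have := Complex.norm_exp_ofReal_mul_I (t / K)
    push_cast at this
    exact this.le
  have h2 : ∀ n : ℕ, Complex.exp (t * (1 / K * n : ℝ) * Complex.I) =
      Complex.exp (t / K * Complex.I) ^ n := fun n => by
    rw [← Complex.exp_nat_mul]
    push_cast
    ring_nf
  simp_rw [h2, integral_pow_nu hm hρ hw, ← Complex.exp_nat_mul, ← Finset.mul_sum] at h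
  convert! h using 2
  ring

variable [IsProbabilityMeasure P]

lemma measureReal_ne_zero (hm : 0 < m) (hρ : 0 < ρ) [IsProbabilityMeasure (nu m ρ)] :
    (nu m ρ).real {0}ᶜ = 1 - emptyProb m ρ := by
  rw [probReal_compl_eq_one_sub (measurableSet_singleton 0), measureReal_def,
    nu_singleton_zero hm hρ, ENNReal.toReal_ofReal (emptyProb_nonneg hm hρ)]

lemma integral_indicator_nu (hm : 0 < m) (hρ : 0 < ρ) [IsProbabilityMeasure (nu m ρ)] (w : ℂ) :
    ∫ n, (if n = 0 then 1 else w) ∂(nu m ρ) = 1 + (1 - emptyProb m ρ : ℝ) * (w - 1) := by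
  have h : ∀ n : ℕ, (if n = 0 then 1 else w) =
      1 + ({0}ᶜ : Set ℕ).indicator (fun _ => w - 1) n := fun n => by
    by_cases hn : n = 0 <;> simp [hn]
  simp_rw [h]
  have hint : Integrable (({0}ᶜ : Set ℕ).indicator fun _ => w - 1) (nu m ρ) :=
    (integrable_const _).indicator (measurableSet_singleton 0).compl
  rw [integral_add (integrable_const _) hint, integral_indicator_const _
    (measurableSet_singleton 0).compl, measureReal_ne_zero hm hρ]
  simp

lemma charFun_numOccupied (hm : 0 < m) (hρ : 0 < ρ) (hlaw : ∀ i, HasLaw (η i) (nu m ρ) P)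
    (hindep : iIndepFun η P) (K : ℕ) (t : ℝ) :
    charFun (P.map fun ω => (numOccupied η K ω : ℝ)) t =
      (1 + (1 - emptyProb m ρ : ℝ) * (Complex.exp (t * Complex.I) - 1)) ^ K := by
  have : IsProbabilityMeasure (nu m ρ) := (hlaw 0).isProbabilityMeasure_iff.1 inferInstance
  have h := charFun_sum hlaw hindep (fun n => if n = 0 then 0 else 1) K t
  rw [← integral_indicator_nu hm hρ]
  convert! h using 4 with ω n
  · simp [numOccupied]
  · split_ifs <;> simp

/-- Chebyshev's inequality for the number of occupied sites. -/
lemma measure_numOccupied_sub_ge (hm : 0 < m) (hρ : 0 < ρ)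
    (hlaw : ∀ i, HasLaw (η i) (nu m ρ) P) (hindep : iIndepFun η P) (K : ℕ) {c : ℝ} (hc : 0 < c) :
    P {ω | c ≤ |(numOccupied η K ω : ℝ) - K * (1 - emptyProb m ρ)|} ≤
      ENNReal.ofReal (K * (1 - emptyProb m ρ) / c ^ 2) := by
  have : IsProbabilityMeasure (nu m ρ) := (hlaw 0).isProbabilityMeasure_iff.1 inferInstance
  let g : ℕ → ℝ := fun n => if n = 0 then 0 else 1
  let Y : ℕ → Ω → ℝ := fun i ω => g (η i ω)
  have hY : ∀ i, AEMeasurable (Y i) P := fun i =>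
    (Measurable.of_discrete (f := g)).comp_aemeasurable (hlaw i).aemeasurable
  have hYb : ∀ i, MemLp (Y i) 2 P := fun i =>
    MemLp.of_bound (hY i).aestronglyMeasurable 1 (Eventually.of_forall fun ω => by
      simp only [Y, g]; split_ifs <;> simp)
  have hind : iIndepFun Y P := hindep.comp (fun _ => g) fun _ => .of_discrete
  have hmean : ∀ i, ∫ ω, Y i ω ∂P = 1 - emptyProb m ρ := fun i => by
    have hg : g = ({0}ᶜ : Set ℕ).indicator fun _ => 1 := by
      ext n; by_cases hn : n = 0 <;> simp [g, hn]
    have : ∫ ω, Y i ω ∂P = ∫ n, g n ∂(nu m ρ) := by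
      rw [← (hlaw i).map_eq, integral_map (hlaw i).aemeasurable .of_discrete]
    rw [this, hg, integral_indicator_const _ (measurableSet_singleton 0).compl,
      measureReal_ne_zero hm hρ, smul_eq_mul, mul_one]
  -- An indicator equals its square, so its second moment is its mean.
  have hvar : ∀ i, variance (Y i) P ≤ 1 - emptyProb m ρ := fun i => by
    refine (variance_le_expectation_sq (hY i).aestronglyMeasurable).trans ?_
    rw [← hmean i]
    refine le_of_eq (integral_congr_ae (Eventually.of_forall fun ω => ?_))
    simp only [Pi.pow_apply, Y, g]
    split_ifs <;> simp
  have hsum : (fun ω => (numOccupied η K ω : ℝ)) = ∑ i ∈ Finset.range K, Y i := by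
    ext ω
    simp [numOccupied, Y, g]
  have hsumL : MemLp (fun ω => (numOccupied η K ω : ℝ)) 2 P := by
    rw [hsum]; exact memLp_finsetSum' _ fun i _ => hYb i
  have hsummean : ∫ ω, (numOccupied η K ω : ℝ) ∂P = K * (1 - emptyProb m ρ) := by
    have : ∀ ω, (numOccupied η K ω : ℝ) = ∑ i ∈ Finset.range K, Y i ω := fun ω => by
      simpa using congrFun hsum ω
    simp_rw [this]
    rw [integral_finsetSum _ fun i _ => (hYb i).integrable (by norm_num)]
    simp [hmean, -mul_eq_mul_left_iff, mul_sub]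
  have hcheb := meas_ge_le_variance_div_sq hsumL hc
  rw [hsummean] at hcheb
  refine hcheb.trans (ENNReal.ofReal_le_ofReal ?_)
  gcongr
  rw [hsum, IndepFun.variance_sum (fun i _ => hYb i) fun i _ j _ hij => hind.indepFun hij]
  refine (Finset.sum_le_sum fun i _ => hvar i).trans_eq ?_
  rw [Finset.sum_const, Finset.card_range, nsmul_eq_mul]

end Sums

/-- Needed to pass from Lévy's theorem for sequences to the limit along `toZero`. -/
instance : toZero.IsCountablyGenerated :=
  inferInstanceAs (comap (fun m : Param => (m : ℝ)) (𝓝 0)).IsCountablyGenerated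

/-! ### Limits in each regime -/

section Limits

variable {ρ : ℝ} {Ω : Param → Type*} [∀ m, MeasurableSpace (Ω m)] {P : ∀ m, Measure (Ω m)}
  {η : ∀ m : Param, ℕ → Ω m → ℕ} {K : Param → ℕ}

lemma tendsto_natCast_mul_occupiedProb (hρ : 0 < ρ) {δ : ℝ}
    (hK : Tendsto (fun m => (K m : ℝ) / kappa m) toZero (𝓝 δ)) :
    Tendsto (fun m : Param => (K m : ℝ) * (1 - emptyProb m ρ)) toZero (𝓝 (δ / 2)) := by
  have h := hK.mul (tendsto_occupiedProb_mul_kappa hρ)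
  rw [mul_one_div] at h
  refine h.congr' ?_
  filter_upwards [eventually_kappa_pos] with m hm
  field_simp

lemma tendsto_occupiedProb (hρ : 0 < ρ) :
    Tendsto (fun m : Param => 1 - emptyProb m ρ) toZero (𝓝 0) := by
  have h1 : Tendsto (fun m : Param => -(m * Real.log m)) toZero (𝓝 0) := by
    simpa using tendsto_mul_log_toZero.neg
  have h := (tendsto_occupiedProb_mul_kappa hρ).mul h1
  rw [mul_zero] at h
  refine h.congr' ?_
  filter_upwards [tendsto_log_toZero.eventually_lt_atBot 0] with m hm
  have h1 := m.2.ne'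
  have h2 := hm.ne
  simp only [kappa]
  field_simp

/-- The argument of the logarithm in the characteristic function of the empirical mean is
`1 + (2ρ / (mK)) y` with `y = K (1 - e^{it/K})`. -/
noncomputable def phaseDefect (K : ℕ) (t : ℝ) : ℂ := K * (1 - Complex.exp (t / K * Complex.I))

/-- From |e^{ix} - 1| ≤ |x|. A bound uniform in K is needed when mK → 0, since K may then stay
bounded. -/
lemma norm_phaseDefect_le (K : ℕ) (t : ℝ) : ‖phaseDefect K t‖ ≤ |t| := by
  rcases K.eq_zero_or_pos with rfl | hK
  · simp [phaseDefect]
  · have h := Real.norm_exp_I_mul_ofReal_sub_one_le (x := t / K)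
    rw [phaseDefect, norm_mul, norm_sub_rev, Complex.norm_natCast]
    have hK' : (0 : ℝ) < K := by exact_mod_cast hK
    push_cast at h
    rw [mul_comm Complex.I, Real.norm_eq_abs, abs_div, Nat.abs_cast, le_div_iff₀ hK'] at h
    linarith

/-- Ensures |1 + (2ρ/s)y| ≥ 1 for s > 0, so the real part of its logarithm is nonnegative. -/
lemma phaseDefect_re_nonneg (K : ℕ) (t : ℝ) : 0 ≤ (phaseDefect K t).re := by
  have h : (phaseDefect K t).re = K * (1 - Real.cos (t / K)) := by
    have e : (t / K : ℂ) = ((t / K : ℝ) : ℂ) := by push_cast; rfl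
    rw [phaseDefect, ← Complex.ofReal_natCast, Complex.re_ofReal_mul, Complex.ofReal_natCast, e,
      Complex.sub_re, Complex.exp_ofReal_mul_I_re, Complex.one_re]
  rw [h]
  exact mul_nonneg K.cast_nonneg (sub_nonneg.2 (Real.cos_le_one _))

lemma tendsto_phaseDefect (t : ℝ) :
    Tendsto (fun K : ℕ => phaseDefect K t) atTop (𝓝 (-(t * Complex.I))) := by
  -- The limit is the derivative of exp at 0, read off slopes at it/K; these require it/K ≠ 0.
  rcases eq_or_ne t 0 with rfl | ht
  · simp [phaseDefect]
  have hz : Tendsto (fun K : ℕ => (t / K * Complex.I : ℂ)) atTop (𝓝[≠] 0) := by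
    refine tendsto_nhdsWithin_iff.2 ⟨?_, ?_⟩
    · have h : Tendsto (fun K : ℕ => ((t / K : ℝ) : ℂ) * Complex.I) atTop
          (𝓝 ((0 : ℝ) * Complex.I)) :=
        (tendsto_const_div_atTop_nhds_zero_nat t).ofReal.mul_const _
      simpa using h
    · filter_upwards [eventually_ne_atTop 0] with K hK
      simp [ht, hK]
  have h := (((Complex.hasDerivAt_exp 0).tendsto_slope).comp hz).mul_const (-(t * Complex.I))
  rw [Complex.exp_zero, one_mul] at h
  refine h.congr' ?_
  filter_upwards [eventually_ne_atTop 0] with K hK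
  have h1 : (K : ℂ) ≠ 0 := by exact_mod_cast hK
  have h2 : (t : ℂ) ≠ 0 := by exact_mod_cast ht
  simp only [Function.comp, slope_def_field, phaseDefect, Complex.exp_zero, sub_zero]
  field_simp [Complex.I_ne_zero]
  ring

lemma charFun_empiricalMean' (hρ : 0 < ρ)
    (hlaw : ∀ m i, HasLaw (η m i) (nu (m : ℝ) ρ) (P m)) (hindep : ∀ m, iIndepFun (η m) (P m))
    (hK : ∀ m, 0 < K m) (m : Param) (t : ℝ) :
    charFun ((P m).map (empiricalMean (η m) (K m))) t =
      Complex.exp (-((K m * m / 2 : ℝ) *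
        Complex.log (1 + (2 * ρ / (K m * m) : ℝ) * phaseDefect (K m) t))) := by
  have h1 : (K m : ℂ) ≠ 0 := by exact_mod_cast (hK m).ne'
  have h2 : ((m : ℝ) : ℂ) ≠ 0 := by exact_mod_cast m.2.ne'
  rw [charFun_empiricalMean m.2 hρ (hlaw m) (hindep m), phaseDefect]
  push_cast
  rw [← neg_mul]
  congr 4
  field_simp

lemma tendsto_atTop_of_mul_toZero {c : ℝ} (hc : 0 < c)
    (hK : ∀ᶠ m in toZero, c < (K m : ℝ) * (m : ℝ)) : Tendsto K toZero atTop := by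
  rw [← tendsto_natCast_atTop_iff (R := ℝ)]
  have h : Tendsto (fun m : Param => c * (m : ℝ)⁻¹) toZero atTop :=
    (tendsto_inv_nhdsGT_zero.comp tendsto_coe_toZero).const_mul_atTop hc
  refine tendsto_atTop_mono' _ ?_ h
  filter_upwards [hK] with m hm
  rw [← div_eq_mul_inv, div_le_iff₀ m.2]
  exact hm.le

variable [∀ m, IsProbabilityMeasure (P m)]

/-- The characteristic function is exp(K log(1 + p(e^{it} - 1))) for small p, with p → 0 and Kp →
δ/2. Allowing δ = 0 also covers K/κ_m → 0, where the Poisson law degenerates to a point mass. -/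
lemma tendstoInLaw_numOccupied_poisson (hρ : 0 < ρ)
    (hlaw : ∀ m i, HasLaw (η m i) (nu (m : ℝ) ρ) (P m)) (hindep : ∀ m, iIndepFun (η m) (P m))
    {δ : ℝ} (hδ : 0 ≤ δ) (hK : Tendsto (fun m => (K m : ℝ) / kappa m) toZero (𝓝 δ)) :
    TendstoInLaw P (fun m ω => numOccupied (η m) (K m) ω) toZero
      (poissonMeasure (δ / 2).toNNReal) := by
  have hmeas : ∀ m, AEMeasurable (numOccupied (η m) (K m)) (P m) := fun m =>
    aemeasurable_numOccupied (fun i => (hlaw m i).aemeasurable) _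
  refine TendstoInLaw.of_natCast hmeas (tendstoInLaw_of_tendsto_charFun (fun m =>
    (Measurable.of_discrete (f := fun n : ℕ => (n : ℝ))).comp_aemeasurable (hmeas m)) fun t => ?_)
  rw [charFun_map_cast_poissonMeasure]
  have hy : Tendsto (fun m : Param => ((1 - emptyProb m ρ : ℝ) : ℂ) *
      (Complex.exp (t * Complex.I) - 1)) toZero (𝓝 0) := by
    simpa using (tendsto_occupiedProb hρ).ofReal.mul_const (Complex.exp (t * Complex.I) - 1)
  have hk : Tendsto (fun m : Param => (K m : ℂ) * (((1 - emptyProb m ρ : ℝ) : ℂ) *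
      (Complex.exp (t * Complex.I) - 1))) toZero
      (𝓝 (((δ / 2).toNNReal : ℂ) * (Complex.exp (t * Complex.I) - 1))) := by
    have h := (tendsto_natCast_mul_occupiedProb hρ hK).ofReal.mul_const
      (Complex.exp (t * Complex.I) - 1)
    have e : (((δ / 2).toNNReal : ℝ) : ℂ) = ((δ / 2 : ℝ) : ℂ) := by
      rw [Real.coe_toNNReal _ (by positivity)]
    rw [← e] at h
    refine h.congr fun m => ?_
    push_cast
    ring
  have h := (Complex.continuous_exp.tendsto _).comp (tendsto_mul_log_one_add hy hk)
  refine h.congr' ?_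
  have hne : ∀ᶠ m : Param in toZero, (1 + ((1 - emptyProb m ρ : ℝ) : ℂ) *
      (Complex.exp (t * Complex.I) - 1)) ≠ 0 := by
    have : Tendsto (fun m : Param => 1 + ((1 - emptyProb m ρ : ℝ) : ℂ) *
      (Complex.exp (t * Complex.I) - 1)) toZero (𝓝 1) := by simpa using hy.const_add 1
    exact this.eventually_ne one_ne_zero
  filter_upwards [hne] with m hm
  rw [charFun_numOccupied m.2 hρ (hlaw m) (hindep m), Function.comp, Complex.exp_nat_mul,
    Complex.exp_log hm]

lemma poissonMeasure_zero : poissonMeasure 0 = Measure.dirac 0 := by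
  refine Measure.ext_of_singleton fun n => ?_
  rw [poissonMeasure_singleton]
  cases n <;> simp

lemma tendsto_measure_numOccupied_ratio (hρ : 0 < ρ)
    (hlaw : ∀ m i, HasLaw (η m i) (nu (m : ℝ) ρ) (P m)) (hindep : ∀ m, iIndepFun (η m) (P m))
    (hK : Tendsto (fun m => (K m : ℝ) / kappa m) toZero atTop) {ε : ℝ} (hε : 0 < ε) :
    Tendsto (fun m => P m {ω | ε ≤ |(numOccupied (η m) (K m) ω : ℝ) /
      ((K m : ℝ) / (2 * kappa m)) - 1|}) toZero (𝓝 0) := by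
  let L : Param → ℝ := fun m => (K m : ℝ) / (2 * kappa m)
  let r : Param → ℝ := fun m => 2 * ((1 - emptyProb m ρ) * kappa m)
  have hL : Tendsto L toZero atTop := by
    refine (hK.atTop_div_const two_pos).congr fun m => ?_
    simp only [L]
    rw [div_div, mul_comm]
  have hr : Tendsto r toZero (𝓝 1) := by
    simpa using (tendsto_occupiedProb_mul_kappa hρ).const_mul 2
  have hbound : Tendsto (fun m => ENNReal.ofReal (r m * (4 / ε ^ 2) / L m)) toZero (𝓝 0) := by
    rw [← ENNReal.ofReal_zero]
    exact ENNReal.tendsto_ofReal ((hr.mul_const _).div_atTop hL)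
  refine tendsto_of_tendsto_of_tendsto_of_le_of_le' tendsto_const_nhds hbound
    (Eventually.of_forall fun m => zero_le) ?_
  have hr' : ∀ᶠ m in toZero, |r m - 1| < ε / 2 := by
    simpa [Real.dist_eq] using hr.eventually (Metric.ball_mem_nhds 1 (half_pos hε))
  filter_upwards [hL.eventually_gt_atTop 0, hr', eventually_kappa_pos] with m hLm hrm hkm
  have hmean : (K m : ℝ) * (1 - emptyProb m ρ) = L m * r m := by
    simp only [L, r]
    field_simp
  -- The mean is Lr with |r - 1| < ε/2, so a deviation of εL from L is one of at least εL/2 from the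
  -- mean. Chebyshev's bound is then 4r/(ε²L).
  have hcheb := measure_numOccupied_sub_ge m.2 hρ (hlaw m) (hindep m) (K m)
    (c := L m * (ε / 2)) (by positivity)
  rw [hmean] at hcheb
  refine (measure_mono fun ω hω => ?_).trans (hcheb.trans (ENNReal.ofReal_le_ofReal (le_of_eq ?_)))
  · simp only [Set.mem_ofPred_eq] at hω ⊢
    have e : (numOccupied (η m) (K m) ω : ℝ) - L m * r m =
        L m * (((numOccupied (η m) (K m) ω : ℝ) / L m - 1) - (r m - 1)) := by
      field_simp
      ring
    rw [e, abs_mul, abs_of_pos hLm]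
    refine mul_le_mul_of_nonneg_left ?_ hLm.le
    have h1 := abs_sub_abs_le_abs_sub ((numOccupied (η m) (K m) ω : ℝ) / L m - 1) (r m - 1)
    change ε ≤ |(numOccupied (η m) (K m) ω : ℝ) / L m - 1| at hω
    linarith
  · field_simp
    ring

lemma tendstoInLaw_numOccupied_top (hρ : 0 < ρ)
    (hlaw : ∀ m i, HasLaw (η m i) (nu (m : ℝ) ρ) (P m)) (hindep : ∀ m, iIndepFun (η m) (P m))
    (hK : Tendsto (fun m => (K m : ℝ) / kappa m) toZero atTop) :
    TendstoInLaw P (fun m ω => (numOccupied (η m) (K m) ω : ℝ≥0∞)) toZero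
      (Measure.dirac (∞ : ℝ≥0∞)) := by
  refine tendstoInLaw_dirac_top (fun m =>
    aemeasurable_numOccupied (fun i => (hlaw m i).aemeasurable) _) fun c => ?_
  refine tendsto_of_tendsto_of_tendsto_of_le_of_le' tendsto_const_nhds
    (tendsto_measure_numOccupied_ratio hρ hlaw hindep hK one_half_pos)
    (Eventually.of_forall fun m => zero_le) ?_
  -- K/κ_m > 4c means K/(2κ_m) > 2c, so Δ ≤ c forces the ratio below 1/2, a deviation of at least
  -- 1/2 from 1.
  filter_upwards [hK.eventually_gt_atTop (4 * c), eventually_kappa_pos] with m hm hkm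
  refine measure_mono fun ω hω => ?_
  simp only [Set.mem_ofPred_eq] at hω ⊢
  have hω' : (numOccupied (η m) (K m) ω : ℝ) ≤ c := by exact_mod_cast hω
  have hL : (2 * c : ℝ) < (K m : ℝ) / (2 * kappa m) := by
    rw [show (K m : ℝ) / (2 * kappa m) = K m / kappa m / 2 by rw [div_div, mul_comm]]
    linarith
  have hc : (0 : ℝ) ≤ c := c.cast_nonneg
  have : (numOccupied (η m) (K m) ω : ℝ) / ((K m : ℝ) / (2 * kappa m)) ≤ 1 / 2 := by
    rw [div_le_iff₀ (by linarith)]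
    linarith
  rw [abs_of_neg (by linarith)]
  linarith

lemma tendstoInLaw_empiricalMean_zero (hρ : 0 < ρ)
    (hlaw : ∀ m i, HasLaw (η m i) (nu (m : ℝ) ρ) (P m)) (hindep : ∀ m, iIndepFun (η m) (P m))
    (hK0 : ∀ m, 0 < K m) (hK : Tendsto (fun m => (K m : ℝ) * (m : ℝ)) toZero (𝓝 0)) :
    TendstoInLaw P (fun m ω => empiricalMean (η m) (K m) ω) toZero (Measure.dirac (0 : ℝ)) := by
  refine tendstoInLaw_of_tendsto_charFun (fun m =>
    aemeasurable_empiricalMean (fun i => (hlaw m i).aemeasurable) _) fun t => ?_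
  have hlim : charFun (Measure.dirac (0 : ℝ)) t = Complex.exp (-0) := by simp [charFun_dirac]
  rw [hlim]
  refine Tendsto.congr (fun m => (charFun_empiricalMean' hρ hlaw hindep hK0 m t).symm) ?_
  refine (Complex.continuous_exp.tendsto _).comp (Tendsto.neg ?_)
  -- The summand 1 keeps B positive at t = 0, so that log(s + B) has a finite limit as s → 0.
  let B : ℝ := 2 * ρ * |t| + 1
  have hB : 0 < B := by positivity
  have hs : ∀ m, 0 < (K m : ℝ) * (m : ℝ) := fun m => mul_pos (Nat.cast_pos.2 (hK0 m)) m.2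
  have hK' : Tendsto (fun m => (K m : ℝ) * (m : ℝ)) toZero (𝓝[>] 0) :=
    tendsto_nhdsWithin_iff.2 ⟨hK, Eventually.of_forall hs⟩
  have hbound : Tendsto (fun m => (K m * m : ℝ) / 2 * (Real.log (K m * m + B) + Real.pi) -
      1 / 2 * ((K m * m : ℝ) * Real.log (K m * m))) toZero (𝓝 0) := by
    have h1 : Tendsto (fun m => Real.log ((K m : ℝ) * m + B)) toZero (𝓝 (Real.log (0 + B))) :=
      (hK.add_const B).log (by positivity)
    have h2 : Tendsto (fun m => (K m * m : ℝ) * Real.log (K m * m)) toZero (𝓝 0) := by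
      refine ((tendsto_log_mul_rpow_nhdsGT_zero one_pos).comp hK').congr fun m => ?_
      simp only [Function.comp, Real.rpow_one, mul_comm (Real.log _)]
    have h3 := ((hK.div_const 2).mul (h1.add_const Real.pi)).sub (h2.const_mul (1 / 2))
    rwa [zero_div, zero_mul, mul_zero, sub_zero] at h3
  refine squeeze_zero_norm (fun m => ?_) hbound
  set s : ℝ := K m * m
  have hs0 : 0 < s := hs m
  set v : ℂ := 1 + (2 * ρ / s : ℝ) * phaseDefect (K m) t
  have hre : 1 ≤ v.re := by
    rw [Complex.add_re, Complex.re_ofReal_mul, Complex.one_re]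
    have := mul_nonneg (by positivity : 0 ≤ 2 * ρ / s) (phaseDefect_re_nonneg (K m) t)
    linarith
  have h1v : 1 ≤ ‖v‖ := hre.trans (Complex.re_le_norm v)
  have hv : ‖v‖ ≤ (s + B) / s := by
    refine (norm_add_le _ _).trans ?_
    rw [norm_one, norm_mul, Complex.norm_real, Real.norm_of_nonneg (by positivity)]
    have h3 := mul_le_mul_of_nonneg_left (norm_phaseDefect_le (K m) t)
      (by positivity : 0 ≤ 2 * ρ / s)
    have h4 : (s + B) / s = 1 + 2 * ρ / s * |t| + 1 / s := by
      simp only [B]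
      field_simp
      ring
    have h5 : 0 < 1 / s := by positivity
    linarith
  -- The real part is log|v| ≥ 0, bounded through |v| ≤ (s + B)/s; the argument contributes at most
  -- π.
  have hlog : ‖Complex.log v‖ ≤ Real.log (s + B) - Real.log s + Real.pi := by
    refine (Complex.norm_le_abs_re_add_abs_im _).trans (add_le_add ?_ ?_)
    · rw [Complex.log_re, abs_of_nonneg (Real.log_nonneg h1v),
        ← Real.log_div (by positivity) hs0.ne']
      exact Real.log_le_log (by linarith) hv
    · rw [Complex.log_im]
      exact Complex.abs_arg_le_pi v
  rw [norm_mul, Complex.norm_real, Real.norm_of_nonneg (by positivity)]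
  calc s / 2 * ‖Complex.log v‖ ≤ s / 2 * (Real.log (s + B) - Real.log s + Real.pi) := by gcongr
    _ = _ := by ring

lemma tendstoInLaw_empiricalMean_gamma (hρ : 0 < ρ)
    (hlaw : ∀ m i, HasLaw (η m i) (nu (m : ℝ) ρ) (P m)) (hindep : ∀ m, iIndepFun (η m) (P m))
    (hK0 : ∀ m, 0 < K m) {γ : ℝ} (hγ : 0 < γ)
    (hK : Tendsto (fun m => (K m : ℝ) * (m : ℝ)) toZero (𝓝 γ)) :
    TendstoInLaw P (fun m ω => empiricalMean (η m) (K m) ω) toZero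
      (gammaMeasure (γ / 2) (2 * ρ / γ)⁻¹) := by
  have hrate : 0 < (2 * ρ / γ)⁻¹ := by positivity
  have : IsProbabilityMeasure (gammaMeasure (γ / 2) (2 * ρ / γ)⁻¹) :=
    isProbabilityMeasure_gammaMeasure (by positivity) hrate
  refine tendstoInLaw_of_tendsto_charFun (fun m =>
    aemeasurable_empiricalMean (fun i => (hlaw m i).aemeasurable) _) fun t => ?_
  rw [charFun_gammaMeasure (by positivity) hrate]
  refine Tendsto.congr (fun m => (charFun_empiricalMean' hρ hlaw hindep hK0 m t).symm) ?_
  have hKtop : Tendsto K toZero atTop :=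
    tendsto_atTop_of_mul_toZero (half_pos hγ) (hK.eventually_const_lt (half_lt_self hγ))
  have hy := (tendsto_phaseDefect t).comp hKtop
  have hx := ((tendsto_const_nhds (x := 2 * ρ)).div hK hγ.ne').ofReal.mul hy
  -- The limit 1 - (2ρ/γ)it has real part 1, so the logarithm is continuous there.
  have hlog := (hx.const_add 1).clog (by
    refine Or.inl ?_
    rw [Complex.add_re, Complex.re_ofReal_mul]
    simp)
  have h := (Complex.continuous_exp.tendsto _).comp ((hK.div_const 2).ofReal.mul hlog).neg
  convert! h using 2
  rw [neg_mul]
  congr 5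
  push_cast
  rw [div_inv_eq_mul]
  ring

lemma tendstoInLaw_empiricalMean_const (hρ : 0 < ρ)
    (hlaw : ∀ m i, HasLaw (η m i) (nu (m : ℝ) ρ) (P m)) (hindep : ∀ m, iIndepFun (η m) (P m))
    (hK0 : ∀ m, 0 < K m) (hK : Tendsto (fun m => (K m : ℝ) * (m : ℝ)) toZero atTop) :
    TendstoInLaw P (fun m ω => empiricalMean (η m) (K m) ω) toZero (Measure.dirac ρ) := by
  refine tendstoInLaw_of_tendsto_charFun (fun m =>
    aemeasurable_empiricalMean (fun i => (hlaw m i).aemeasurable) _) fun t => ?_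
  have hlim : charFun (Measure.dirac ρ) t = Complex.exp (-(ρ * -(t * Complex.I))) := by
    rw [charFun_dirac]
    simp [mul_comm, mul_left_comm]
  rw [hlim]
  refine Tendsto.congr (fun m => (charFun_empiricalMean' hρ hlaw hindep hK0 m t).symm) ?_
  have hy := (tendsto_phaseDefect t).comp
    (tendsto_atTop_of_mul_toZero one_pos (hK.eventually_gt_atTop 1))
  have hx := ((tendsto_const_nhds (x := 2 * ρ)).div_atTop hK).ofReal.mul hy
  rw [Complex.ofReal_zero, zero_mul] at hx
  refine (Complex.continuous_exp.tendsto _).comp (tendsto_mul_log_one_add hx ?_).neg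
  -- The prefactor s/2 times the small quantity (2ρ/s)y is exactly ρy.
  refine (hy.const_mul (ρ : ℂ)).congr fun m => ?_
  have h1 : (K m : ℂ) ≠ 0 := by exact_mod_cast (hK0 m).ne'
  have h2 : ((m : ℝ) : ℂ) ≠ 0 := by exact_mod_cast m.2.ne'
  push_cast
  simp only [Function.comp]
  field_simp

end Limits

end InclusionProcess

/-! ### The main theorem -/

theorem mainTheorem6 {ρ : ℝ} (hρ : 0 < ρ)
    {Ω : InclusionProcess.Param → Type*} [∀ m, MeasurableSpace (Ω m)]
    (P : ∀ m, Measure (Ω m)) [∀ m, IsProbabilityMeasure (P m)]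
    (η : ∀ m : InclusionProcess.Param, ℕ → Ω m → ℕ)
    (hlaw : ∀ m i, HasLaw (η m i) (InclusionProcess.nu (m : ℝ) ρ) (P m))
    (hindep : ∀ m, iIndepFun (η m) (P m))
    (K : InclusionProcess.Param → ℕ) (hK : ∀ m, 0 < K m) :
    -- the number of occupied sites, on the scale `κ_m`
    (Tendsto (fun m => (K m : ℝ) / InclusionProcess.kappa m) InclusionProcess.toZero (𝓝 0) →
      InclusionProcess.TendstoInLaw P
        (fun m ω => InclusionProcess.numOccupied (η m) (K m) ω)
        InclusionProcess.toZero (Measure.dirac (0 : ℕ))) ∧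
    (∀ δ : ℝ, 0 < δ →
      Tendsto (fun m => (K m : ℝ) / InclusionProcess.kappa m) InclusionProcess.toZero (𝓝 δ) →
      InclusionProcess.TendstoInLaw P
        (fun m ω => InclusionProcess.numOccupied (η m) (K m) ω)
        InclusionProcess.toZero (poissonMeasure (δ / 2).toNNReal)) ∧
    (Tendsto (fun m => (K m : ℝ) / InclusionProcess.kappa m) InclusionProcess.toZero atTop →
      InclusionProcess.TendstoInLaw P
        (fun m ω => (InclusionProcess.numOccupied (η m) (K m) ω : ℝ≥0∞))
        InclusionProcess.toZero (Measure.dirac (∞ : ℝ≥0∞)) ∧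
      ∀ ε : ℝ, 0 < ε →
        Tendsto
          (fun m => P m {ω | ε ≤
            |(InclusionProcess.numOccupied (η m) (K m) ω : ℝ) /
              ((K m : ℝ) / (2 * InclusionProcess.kappa m)) - 1|})
          InclusionProcess.toZero (𝓝 0)) ∧
    -- the scale `1 / m` is larger than `κ_m`
    Tendsto (fun m : InclusionProcess.Param => (1 / (m : ℝ)) / InclusionProcess.kappa m)
      InclusionProcess.toZero atTop ∧
    -- the empirical mean, on the scale `1 / m`
    (Tendsto (fun m => (K m : ℝ) * (m : ℝ)) InclusionProcess.toZero (𝓝 0) →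
      InclusionProcess.TendstoInLaw P
        (fun m ω => InclusionProcess.empiricalMean (η m) (K m) ω)
        InclusionProcess.toZero (Measure.dirac (0 : ℝ))) ∧
    (∀ γ : ℝ, 0 < γ →
      Tendsto (fun m => (K m : ℝ) * (m : ℝ)) InclusionProcess.toZero (𝓝 γ) →
      -- `gammaMeasure` takes shape and rate; the rate is the inverse of the scale `2 ρ / γ`
      InclusionProcess.TendstoInLaw P
        (fun m ω => InclusionProcess.empiricalMean (η m) (K m) ω)
        InclusionProcess.toZero (gammaMeasure (γ / 2) (2 * ρ / γ)⁻¹) ∧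
      Integrable (fun x : ℝ => x) (gammaMeasure (γ / 2) (2 * ρ / γ)⁻¹) ∧
      ∫ x, x ∂(gammaMeasure (γ / 2) (2 * ρ / γ)⁻¹) = ρ) ∧
    (Tendsto (fun m => (K m : ℝ) * (m : ℝ)) InclusionProcess.toZero atTop →
      InclusionProcess.TendstoInLaw P
        (fun m ω => InclusionProcess.empiricalMean (η m) (K m) ω)
        InclusionProcess.toZero (Measure.dirac ρ)) := by
  refine ⟨fun h => ?_, fun δ hδ h => ?_, fun h => ⟨?_, fun ε hε => ?_⟩, ?_, fun h => ?_,
    fun γ hγ h => ⟨?_, ?_, ?_⟩, fun h => ?_⟩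
  · rw [← InclusionProcess.poissonMeasure_zero]
    simpa using InclusionProcess.tendstoInLaw_numOccupied_poisson hρ hlaw hindep le_rfl h
  · exact InclusionProcess.tendstoInLaw_numOccupied_poisson hρ hlaw hindep hδ.le h
  · exact InclusionProcess.tendstoInLaw_numOccupied_top hρ hlaw hindep h
  · exact InclusionProcess.tendsto_measure_numOccupied_ratio hρ hlaw hindep h hε
  · exact InclusionProcess.tendsto_inv_div_kappa
  · exact InclusionProcess.tendstoInLaw_empiricalMean_zero hρ hlaw hindep hK h
  · exact InclusionProcess.tendstoInLaw_empiricalMean_gamma hρ hlaw hindep hK hγ h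
  · exact InclusionProcess.integrable_id_gammaMeasure (by positivity) (by positivity)
  · rw [InclusionProcess.integral_id_gammaMeasure (by positivity) (by positivity)]
    field_simp
  · exact InclusionProcess.tendstoInLaw_empiricalMean_const hρ hlaw hindep hK h
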